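/- Let $d\ge 1$, let $\rho$ be the Euclidean distance in $\mathbb{R}^d$, $B(x,r)=\{y:\rho(x,y)\le r\}$ and $V_d=\pi^{d/2}/\Gamma(d/2+1)$. Put $G(t)=0$ for $0\le t<1$ and $G(t)=t\log t$ for $t\ge 1$. For a probability density $f$ in $\mathbb{R}^d$ (with respect to Lebesgue measure), $x\in\mathbb{R}^d$ and $r,R>0$ set $$I_f(x,r)=\frac{1}{r^dV_d}\int_{B(x,r)}f(y)\,dy,\qquad M_f(x,R)=\sup_{r\in(0,R]}I_f(x,r),\qquad m_f(x,R)=\inf_{r\in(0,R]}I_f(x,r),$$ and for $\varepsilon>0$ define the following functionals with values in $[0,\infty]$: $$K_f(\varepsilon)=\int_{\mathbb{R}^d}\Big(\int_{\mathbb{R}^d\setminus\{x\}}G\big(|\log\rho(x,y)|\big)f(y)\,dy\Big)^{1+\varepsilon}f(x)\,dx,$$ $$Q_f(\varepsilon,R)=\int_{\mathbb{R}^d}M_f(x,R)^{\varepsilon}f(x)\,dx,\qquad T_f(\varepsilon,R)=\int_{\mathbb{R}^d}m_f(x,R)^{-\varepsilon}f(x)\,dx,$$ where $1/0:=\infty$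 and $0\cdot\infty:=0$. Let $X_1,X_2,\ldots$ be i.i.d. random vectors in $\mathbb{R}^d$ with density $f$. For $N\ge 2$ let $\rho_i=\min\{\rho(X_i,X_j): 1\le j\le N,\ j\ne i\}$, $\overline{\rho}=(\rho_1\cdots\rho_N)^{1/N}$ and let $$H_N=d\log\overline{\rho}+\log V_d+\gamma+\log(N-1),\qquad \gamma=-\int_{(0,\infty)}e^{-t}\log t\,dt,$$ be the Kozachenko--Leonenko estimate. If, for some $\varepsilon>0$, the quantities $K_f(\varepsilon)$, $Q_f(\varepsilon,\varepsilon)$ and $T_f(\varepsilon,\varepsilon)$ are all finite, then $f\log f$ is integrable (with $0\log 0:=0$), so that the entropy $H=-\int_{\mathbb{R}^d}f(x)\log f(x)\,dx$ is finite; $H_N$ is integrable for all sufficiently large $N$; and $$\lim_{N\to\infty}\mathsf{E}H_N=H.$$ -/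

import Mathlib

open MeasureTheory ProbabilityTheory Filter Topology
open scoped ENNReal

namespace KozachenkoLeonenko

noncomputable section

/-- `f` is a probability density with respect to the Lebesgue measure of `ℝ^d`. -/
structure IsProbDensity {d : ℕ} (f : EuclideanSpace ℝ (Fin d) → ℝ) : Prop where
  nonneg : ∀ x, 0 ≤ f x
  integrable : Integrable f volume
  integral_eq_one : ∫ x, f x = 1

/-- The probability law on `ℝ^d` whose Lebesgue density is `f`. -/
def densityLaw {d : ℕ} (f : EuclideanSpace ℝ (Fin d) → ℝ) :
    Measure (EuclideanSpace ℝ (Fin d)) :=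
  volume.withDensity (fun x => ENNReal.ofReal (f x))

/-- The (differential) Shannon entropy of a density; `Real.log 0 = 0` gives `0 log 0 = 0`. -/
def entropy {d : ℕ} (f : EuclideanSpace ℝ (Fin d) → ℝ) : ℝ :=
  -∫ x, f x * Real.log (f x)

/-- The volume of the Euclidean unit ball of `ℝ^d`. -/
def ballVol (d : ℕ) : ℝ :=
  Real.pi ^ ((d : ℝ) / 2) / Real.Gamma ((d : ℝ) / 2 + 1)

/-- Euler's constant, as minus the integral of `exp (-t) * log t` over the half-line. -/
def eulerGamma : ℝ :=
  -∫ t in Set.Ioi (0 : ℝ), Real.exp (-t) * Real.log t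

/-- The distance from the `i`-th sample point to its nearest neighbour among the other points.
For `N ≥ 2` this is an infimum over a finite nonempty set, hence a minimum. -/
def nearestDist {d N : ℕ} (x : Fin N → EuclideanSpace ℝ (Fin d)) (i : Fin N) : ℝ :=
  ⨅ j : {j : Fin N // j ≠ i}, dist (x i) (x j)

/-- The geometric mean of the nearest neighbour distances. -/
def meanDist {d N : ℕ} (x : Fin N → EuclideanSpace ℝ (Fin d)) : ℝ :=
  (∏ i, nearestDist x i) ^ (1 / (N : ℝ))

/-- The Kozachenko-Leonenko estimate computed from a sample of `N ≥ 2` points of `ℝ^d`. -/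
def klEstimate {d N : ℕ} (x : Fin N → EuclideanSpace ℝ (Fin d)) : ℝ :=
  (d : ℝ) * Real.log (meanDist x) + Real.log (ballVol d) + eulerGamma + Real.log ((N : ℝ) - 1)

/-- `G(t) = 0` for `t < 1` and `G(t) = t log t` for `t ≥ 1`. -/
def G (t : ℝ) : ℝ :=
  if t < 1 then 0 else t * Real.log t

/-- The average of `f` over the closed ball of radius `r` centred at `x`. -/
def ballAvg {d : ℕ} (f : EuclideanSpace ℝ (Fin d) → ℝ) (x : EuclideanSpace ℝ (Fin d))
    (r : ℝ) : ℝ≥0∞ :=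
  (∫⁻ y in Metric.closedBall x r, ENNReal.ofReal (f y)) / ENNReal.ofReal (r ^ d * ballVol d)

/-- The supremum of the averages over the balls of radius `r ∈ (0, R]`. -/
def maxAvg {d : ℕ} (f : EuclideanSpace ℝ (Fin d) → ℝ) (x : EuclideanSpace ℝ (Fin d))
    (R : ℝ) : ℝ≥0∞ :=
  ⨆ r ∈ Set.Ioc (0 : ℝ) R, ballAvg f x r

/-- The infimum of the averages over the balls of radius `r ∈ (0, R]`. -/
def minAvg {d : ℕ} (f : EuclideanSpace ℝ (Fin d) → ℝ) (x : EuclideanSpace ℝ (Fin d))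
    (R : ℝ) : ℝ≥0∞ :=
  ⨅ r ∈ Set.Ioc (0 : ℝ) R, ballAvg f x r

/-- `K_f(ε)`; the inner integral omits the point `y = x`, where `log ‖x - y‖` is undefined. -/
def K {d : ℕ} (f : EuclideanSpace ℝ (Fin d) → ℝ) (ε : ℝ) : ℝ≥0∞ :=
  ∫⁻ x, (∫⁻ y in {x}ᶜ, ENNReal.ofReal (G |Real.log (dist x y)|) * ENNReal.ofReal (f y)) ^ (1 + ε)
    * ENNReal.ofReal (f x)

/-- `Q_f(ε, R)`. -/
def Q {d : ℕ} (f : EuclideanSpace ℝ (Fin d) → ℝ) (ε R : ℝ) : ℝ≥0∞ :=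
  ∫⁻ x, maxAvg f x R ^ ε * ENNReal.ofReal (f x)

/-- `T_f(ε, R)`; for `ε > 0` the power `0 ^ (-ε)` is `∞`, and points with `f x = 0`
contribute nothing (`∞ * 0 = 0`). -/
def T {d : ℕ} (f : EuclideanSpace ℝ (Fin d) → ℝ) (ε R : ℝ) : ℝ≥0∞ :=
  ∫⁻ x, minAvg f x R ^ (-ε) * ENNReal.ofReal (f x)

end

end KozachenkoLeonenko

open KozachenkoLeonenko

namespace KozachenkoLeonenko

/-! Put n = N - 1 and let ζ_i be n times the volume of the ball around the i-th sample point that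
reaches its nearest neighbour. Almost surely H_N is the average of the log ζ_i plus γ, and every ζ_i
has the law of `scaledDist` under `sampleLaw f n`, so it suffices that E log ζ tends to H - γ.

The logarithm is cut at radius R: log ζ = log min(ζ, n V_d R^d) + d log⁺(ρ/R), where ρ is the
nearest neighbour distance (`log_scaledDist`).

Near part (`tendsto_integral_log_min`): E log U is the integral of (P(U > u) - 1_{u<1})/u over u >
0. By Lebesgue differentiation P(ζ > u) tends to ∫ exp(-u f) f, which is the tail of τ/f(X) with τ
standard exponential independent of X. The functional Q bounds 1 - P(ζ > u) by a multiple of u^a,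
and T bounds P(ζ > u) by a multiple of u^(-b), so convergence is dominated. The limit is E log τ - E
log f(X) = -γ + H, and the same domination makes log f(X) integrable (`integrable_log_version`).

Far part (`tendsto_integral_posLog`): on one probability space ρ decreases as points are added and
almost surely drops to R or below, so log⁺(ρ/R) tends to 0. It is dominated by its value for a
single neighbour, which is integrable because K is finite. -/

/-! ### Expectation of a logarithm from the tail. -/

/-- The integrand of the representation `log s = ∫ u in (0, ∞), (1_{u < s} - 1_{u < 1}) / u`. -/
noncomputable def logKernel (s u : ℝ) : ℝ :=
  ((if u < s then 1 else 0) - if u < 1 then 1 else 0) / u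

lemma measurable_logKernel : Measurable fun p : ℝ × ℝ => logKernel p.1 p.2 := by
  unfold logKernel
  refine Measurable.div (Measurable.sub ?_ ?_) measurable_snd
  · exact Measurable.ite (measurableSet_lt measurable_snd measurable_fst) measurable_const
      measurable_const
  · exact Measurable.ite (measurableSet_lt measurable_snd measurable_const) measurable_const
      measurable_const

lemma integral_logKernel {s : ℝ} (hs : 0 < s) :
    ∫ u in Set.Ioi (0 : ℝ), logKernel s u = Real.log s := by
  rcases le_total 1 s with h | h
  · have h1 : ∀ u ∈ Set.Ioi (0 : ℝ), logKernel s u = (Set.Ico 1 s).indicator (fun u => u⁻¹) u := by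
      intro u hu
      unfold logKernel Set.indicator
      by_cases h2 : u < 1
      · have : u < s := by linarith
        simp [h2, this]
      · by_cases h3 : u < s <;> simp [h2, h3, not_lt.1 h2]
    rw [setIntegral_congr_fun measurableSet_Ioi h1, setIntegral_indicator measurableSet_Ico,
      Set.inter_eq_right.2 (show Set.Ico 1 s ⊆ Set.Ioi 0 from
        fun u hu => lt_of_lt_of_le one_pos hu.1),
      integral_Ico_eq_integral_Ioc, ← intervalIntegral.integral_of_le h,
      integral_inv_of_pos one_pos hs, div_one]
  · have h1 : ∀ u ∈ Set.Ioi (0 : ℝ), logKernel s u =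
        -(Set.Ico s 1).indicator (fun u => u⁻¹) u := by
      intro u hu
      unfold logKernel Set.indicator
      by_cases h2 : u < s
      · have : u < 1 := by linarith
        simp [h2, this]
      · by_cases h3 : u < 1 <;> simp [h2, h3, not_lt.1 h2, neg_div]
    rw [setIntegral_congr_fun measurableSet_Ioi h1, integral_neg,
      setIntegral_indicator measurableSet_Ico,
      Set.inter_eq_right.2 (show Set.Ico s 1 ⊆ Set.Ioi 0 from
        fun u hu => lt_of_lt_of_le hs hu.1),
      integral_Ico_eq_integral_Ioc, ← intervalIntegral.integral_of_le h,
      integral_inv_of_pos hs one_pos, one_div, Real.log_inv, neg_neg]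

lemma integral_logKernel_law {ν : Measure ℝ} [IsProbabilityMeasure ν] (u : ℝ) :
    ∫ s, logKernel s u ∂ν = (ν.real (Set.Ioi u) - if u < 1 then 1 else 0) / u := by
  unfold logKernel
  rw [integral_div, integral_sub]
  · have : (fun s : ℝ => if u < s then (1 : ℝ) else 0) = (Set.Ioi u).indicator 1 := by
      ext s; simp [Set.indicator]
    rw [this, integral_indicator_one measurableSet_Ioi]
    simp
  · have : (fun s : ℝ => if u < s then (1 : ℝ) else 0) = (Set.Ioi u).indicator 1 := by
      ext s; simp [Set.indicator]
    rw [this]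
    exact (integrable_const (1 : ℝ)).indicator measurableSet_Ioi
  · exact integrable_const _

lemma integrable_logKernel {ν : Measure ℝ} [IsProbabilityMeasure ν] (u : ℝ) :
    Integrable (fun s => logKernel s u) ν := by
  unfold logKernel
  refine Integrable.div_const (Integrable.sub ?_ (integrable_const _)) _
  have : (fun s : ℝ => if u < s then (1 : ℝ) else 0) = (Set.Ioi u).indicator 1 := by
    ext s; simp [Set.indicator]
  rw [this]
  exact (integrable_const (1 : ℝ)).indicator measurableSet_Ioi

/-- For fixed u the kernel has constant sign in s. Absolute integrability on the product space
therefore reduces to integrability of the tail expression in u, which is what Fubini needs below. -/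
lemma integral_norm_logKernel {ν : Measure ℝ} [IsProbabilityMeasure ν] {u : ℝ} :
    ∫ s, ‖logKernel s u‖ ∂ν = ‖∫ s, logKernel s u ∂ν‖ := by
  have key : ∀ c : ℝ, (c = 1 ∨ c = -1) → (∀ s, ‖logKernel s u‖ = c * logKernel s u) →
      ∫ s, ‖logKernel s u‖ ∂ν = ‖∫ s, logKernel s u ∂ν‖ := by
    intro c hc h
    have h0 : 0 ≤ c * ∫ s, logKernel s u ∂ν := by
      rw [← integral_const_mul]
      exact integral_nonneg fun s => by simp only [Pi.zero_apply]; rw [← h]; positivity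
    simp_rw [h, integral_const_mul]
    rw [← abs_of_nonneg h0, abs_mul, Real.norm_eq_abs]
    rcases hc with rfl | rfl <;> simp
  rcases le_or_gt 0 u with hu | hu
  · by_cases h1 : u < 1
    · refine key (-1) (Or.inr rfl) fun s => ?_
      unfold logKernel
      by_cases h2 : u < s <;> simp [h1, h2, abs_of_nonneg hu, neg_div]
    · refine key 1 (Or.inl rfl) fun s => ?_
      unfold logKernel
      by_cases h2 : u < s <;> simp [h1, h2, abs_of_nonneg hu]
  · refine key 1 (Or.inl rfl) fun s => ?_
    have h1 : u < 1 := by linarith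
    unfold logKernel
    by_cases h2 : u < s <;> simp [h1, h2, abs_of_neg hu, neg_div]

lemma integrable_log_of_tail_law {ν : Measure ℝ} [IsProbabilityMeasure ν]
    (hpos : ∀ᵐ s ∂ν, 0 < s)
    (hint : IntegrableOn (fun u => (ν.real (Set.Ioi u) - if u < 1 then 1 else 0) / u)
      (Set.Ioi 0)) :
    Integrable Real.log ν ∧
      ∫ s, Real.log s ∂ν =
        ∫ u in Set.Ioi (0 : ℝ), (ν.real (Set.Ioi u) - if u < 1 then 1 else 0) / u := by
  have hprod : Integrable (Function.uncurry logKernel)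
      (ν.prod (volume.restrict (Set.Ioi (0 : ℝ)))) := by
    have hm : Measurable (Function.uncurry logKernel) := measurable_logKernel
    rw [integrable_prod_iff' hm.aestronglyMeasurable]
    refine ⟨ae_of_all _ fun u => integrable_logKernel u, ?_⟩
    simp only [Function.uncurry]
    simp_rw [integral_norm_logKernel, integral_logKernel_law]
    exact hint.norm
  have hlog : ∀ᵐ s ∂ν, ∫ u in Set.Ioi (0 : ℝ), logKernel s u = Real.log s :=
    hpos.mono fun s hs => integral_logKernel hs
  refine ⟨hprod.integral_prod_left.congr hlog, ?_⟩
  rw [← integral_congr_ae hlog, integral_integral_swap hprod]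
  simp_rw [integral_logKernel_law]

/-- The expectation of the logarithm of a positive random variable, from its tail. -/
theorem integrable_log_of_tail {Ω : Type*} [MeasurableSpace Ω] {P : Measure Ω}
    [IsProbabilityMeasure P] {U : Ω → ℝ} (hU : AEMeasurable U P) (hpos : ∀ᵐ ω ∂P, 0 < U ω)
    {S : ℝ → ℝ} (hS : ∀ u, 0 < u → P.real {ω | u < U ω} = S u)
    (hint : IntegrableOn (fun u => (S u - if u < 1 then 1 else 0) / u) (Set.Ioi 0)) :
    Integrable (fun ω => Real.log (U ω)) P ∧
      ∫ ω, Real.log (U ω) ∂P =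
        ∫ u in Set.Ioi (0 : ℝ), (S u - if u < 1 then 1 else 0) / u := by
  have : IsProbabilityMeasure (P.map U) := Measure.isProbabilityMeasure_map hU
  have h1 : ∀ u ∈ Set.Ioi (0 : ℝ), (S u - if u < 1 then 1 else 0) / u =
      ((P.map U).real (Set.Ioi u) - if u < 1 then 1 else 0) / u := by
    intro u hu
    rw [← hS u hu, map_measureReal_apply_of_aemeasurable hU measurableSet_Ioi]
    rfl
  have h2 := integrable_log_of_tail_law (ν := P.map U)
    ((ae_map_iff hU measurableSet_Ioi).2 hpos) (hint.congr_fun h1 measurableSet_Ioi)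
  rw [integrable_map_measure Real.measurable_log.aestronglyMeasurable hU,
    integral_map hU Real.measurable_log.aestronglyMeasurable] at h2
  rw [setIntegral_congr_fun measurableSet_Ioi h1]
  exact h2

/-! ### Nearest neighbour distance under a product law. -/

section MinDist

/-- The smallest distance from `x` to the points of the family `y`. -/
noncomputable def minDist {E : Type*} [PseudoMetricSpace E] {n : ℕ} (x : E) (y : Fin n → E) : ℝ :=
  ⨅ k, dist x (y k)

variable {E : Type*} [MetricSpace E] {n : ℕ}

lemma minDist_nonneg (x : E) (y : Fin n → E) : 0 ≤ minDist x y :=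
  Real.iInf_nonneg fun _ => dist_nonneg

lemma minDist_le (x : E) (y : Fin n → E) (k : Fin n) : minDist x y ≤ dist x (y k) :=
  ciInf_le (Set.finite_range _).bddBelow k

lemma lt_minDist_iff (hn : n ≠ 0) {r : ℝ} (x : E) (y : Fin n → E) :
    r < minDist x y ↔ ∀ k, r < dist x (y k) := by
  have : Nonempty (Fin n) := ⟨⟨0, Nat.pos_of_ne_zero hn⟩⟩
  refine ⟨fun h k => h.trans_le (minDist_le x y k), fun h => ?_⟩
  obtain ⟨k, hk⟩ := exists_eq_ciInf_of_finite (f := fun k => dist x (y k))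
  rw [minDist, ← hk]
  exact h k

lemma minDist_le_iff (hn : n ≠ 0) {r : ℝ} (x : E) (y : Fin n → E) :
    minDist x y ≤ r ↔ ∃ k, dist x (y k) ≤ r := by
  rw [← not_lt, lt_minDist_iff hn]
  simp

variable [MeasurableSpace E] [BorelSpace E] [SecondCountableTopology E]

lemma measurable_minDist : Measurable fun z : E × (Fin n → E) => minDist z.1 z.2 :=
  Measurable.iInf fun _ => measurable_fst.dist ((measurable_pi_apply _).comp measurable_snd)

lemma measurable_measure_closedBall (μ : Measure E) [SFinite μ] (r : ℝ) :
    Measurable fun x => μ (Metric.closedBall x r) := by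
  have h : MeasurableSet {z : E × E | dist z.2 z.1 ≤ r} :=
    measurableSet_le (measurable_snd.dist measurable_fst) measurable_const
  exact measurable_measure_prodMk_left (ν := μ) h

variable (μ : Measure E) [IsProbabilityMeasure μ]

lemma measure_lt_minDist (hn : n ≠ 0) (r : ℝ) :
    (μ.prod (Measure.pi fun _ : Fin n => μ)) {z | r < minDist z.1 z.2} =
      ∫⁻ x, (1 - μ (Metric.closedBall x r)) ^ n ∂μ := by
  rw [Measure.prod_apply (measurableSet_lt measurable_const measurable_minDist)]
  refine lintegral_congr fun x => ?_
  have : (Prod.mk x ⁻¹' {z : E × (Fin n → E) | r < minDist z.1 z.2}) =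
      Set.univ.pi fun _ => (Metric.closedBall x r)ᶜ := by
    ext y
    simp [lt_minDist_iff hn, dist_comm]
  rw [this, Measure.pi_pi, Finset.prod_const, Finset.card_univ, Fintype.card_fin,
    prob_compl_eq_one_sub Metric.isClosed_closedBall.measurableSet]

/-- Union bound over the n points. A probability is at most its own a-th power when a ≤ 1, which
makes the exponent free. -/
lemma measure_minDist_le (hn : n ≠ 0) (r : ℝ) {a : ℝ} (ha : 0 ≤ a) (ha1 : a ≤ 1) :
    (μ.prod (Measure.pi fun _ : Fin n => μ)) {z | minDist z.1 z.2 ≤ r} ≤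
      ∫⁻ x, (n * μ (Metric.closedBall x r)) ^ a ∂μ := by
  rw [Measure.prod_apply (measurableSet_le measurable_minDist measurable_const)]
  refine lintegral_mono fun x => ?_
  set s := Prod.mk x ⁻¹' {z : E × (Fin n → E) | minDist z.1 z.2 ≤ r}
  have hs : s ⊆ ⋃ k, (Function.eval k) ⁻¹' Metric.closedBall x r := by
    intro y hy
    obtain ⟨k, hk⟩ := (minDist_le_iff hn x y).1 hy
    exact Set.mem_iUnion.2 ⟨k, by simpa [dist_comm] using hk⟩
  have h1 : (Measure.pi fun _ : Fin n => μ) s ≤ n * μ (Metric.closedBall x r) := by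
    refine (measure_mono hs).trans ((measure_iUnion_le _).trans ?_)
    have : ∀ k : Fin n, (Measure.pi fun _ : Fin n => μ)
        ((Function.eval k) ⁻¹' Metric.closedBall x r) = μ (Metric.closedBall x r) := fun k =>
      (measurePreserving_eval (fun _ : Fin n => μ) k).measure_preimage
        Metric.isClosed_closedBall.measurableSet.nullMeasurableSet
    simp_rw [this]
    simp
  calc (Measure.pi fun _ : Fin n => μ) s
      = (Measure.pi fun _ : Fin n => μ) s ^ (1 : ℝ) := (ENNReal.rpow_one _).symm
    _ ≤ (Measure.pi fun _ : Fin n => μ) s ^ a :=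
        ENNReal.rpow_le_rpow_of_exponent_ge prob_le_one ha1
    _ ≤ _ := ENNReal.rpow_le_rpow h1 ha

/-- With t = np, (1 - p)^n ≤ exp(-t), and t/a ≤ exp(t/a) raised to the power a gives t^a ≤ a^a
exp(t). -/
lemma one_sub_pow_le_rpow_neg {p : ℝ≥0∞} (hp : p ≤ 1) (n : ℕ) {a : ℝ} (ha : 0 < a) :
    (1 - p) ^ n ≤ ENNReal.ofReal (a ^ a) * (n * p) ^ (-a) := by
  have hC : 0 < a ^ a := Real.rpow_pos_of_pos ha a
  rcases eq_or_ne (n * p) 0 with h0 | h0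
  · rw [h0, ENNReal.zero_rpow_of_neg (neg_lt_zero.2 ha), ENNReal.mul_top (by simpa using hC)]
    exact le_top
  lift p to NNReal using ne_top_of_le_ne_top ENNReal.one_ne_top hp
  have hp1 : (p : ℝ) ≤ 1 := by exact_mod_cast hp
  set t : ℝ := n * p with ht
  have htE : (n * p : ℝ≥0∞) = ENNReal.ofReal t := by
    rw [ht, ENNReal.ofReal_mul (Nat.cast_nonneg _)]
    simp
  have ht0 : 0 < t := by
    rw [htE] at h0
    simpa using h0
  have h1 : (1 - (p : ℝ≥0∞)) ^ n = ENNReal.ofReal ((1 - p) ^ n) := by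
    rw [ENNReal.ofReal_pow (by linarith), ENNReal.ofReal_sub _ p.coe_nonneg]
    simp
  rw [h1, htE, ENNReal.ofReal_rpow_of_pos ht0, ← ENNReal.ofReal_mul hC.le]
  refine ENNReal.ofReal_le_ofReal ?_
  have h2 : (1 - (p : ℝ)) ^ n ≤ Real.exp (-t) := by
    calc (1 - (p : ℝ)) ^ n ≤ Real.exp (-p) ^ n :=
          pow_le_pow_left₀ (by linarith) (by linarith [Real.add_one_le_exp (-(p : ℝ))]) n
      _ = Real.exp (-t) := by rw [← Real.exp_nat_mul, ht]; ring_nf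
  refine h2.trans ?_
  rw [Real.exp_neg, Real.rpow_neg ht0.le, ← div_eq_mul_inv, inv_eq_one_div,
    div_le_div_iff₀ (Real.exp_pos _) (Real.rpow_pos_of_pos ht0 _), one_mul]
  calc t ^ a = a ^ a * (t / a) ^ a := by
        rw [← Real.mul_rpow ha.le (by positivity), mul_div_cancel₀ _ ha.ne']
    _ ≤ a ^ a * (Real.exp (t / a)) ^ a := by
        gcongr
        linarith [Real.add_one_le_exp (t / a)]
    _ = a ^ a * Real.exp t := by rw [← Real.exp_mul, div_mul_cancel₀ _ ha.ne']

lemma measure_lt_minDist_le (hn : n ≠ 0) (r : ℝ) {a : ℝ} (ha : 0 < a) :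
    (μ.prod (Measure.pi fun _ : Fin n => μ)) {z | r < minDist z.1 z.2} ≤
      ENNReal.ofReal (a ^ a) * ∫⁻ x, (n * μ (Metric.closedBall x r)) ^ (-a) ∂μ := by
  rw [measure_lt_minDist μ hn, ← lintegral_const_mul' _ _ ENNReal.ofReal_ne_top]
  exact lintegral_mono fun x => one_sub_pow_le_rpow_neg prob_le_one n ha

lemma measureReal_lt_minDist (hn : n ≠ 0) (r : ℝ) :
    (μ.prod (Measure.pi fun _ : Fin n => μ)).real {z | r < minDist z.1 z.2} =
      ∫ x, (1 - μ.real (Metric.closedBall x r)) ^ n ∂μ := by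
  rw [integral_eq_lintegral_of_nonneg_ae
    (ae_of_all _ fun x => pow_nonneg (sub_nonneg.2 measureReal_le_one) n)
    (((measurable_measure_closedBall μ r).ennreal_toReal.const_sub 1).pow_const
      n).aestronglyMeasurable, measureReal_def, measure_lt_minDist μ hn]
  congr 1
  refine lintegral_congr fun x => ?_
  rw [ENNReal.ofReal_pow (sub_nonneg.2 measureReal_le_one),
    ENNReal.ofReal_sub _ measureReal_nonneg]
  simp [Measure.real]

lemma minDist_pos_ae [NullSingletonClass μ] (hn : n ≠ 0) :
    ∀ᵐ z ∂(μ.prod (Measure.pi fun _ : Fin n => μ)), 0 < minDist z.1 z.2 := by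
  have h := measure_lt_minDist μ hn 0
  simp only [Metric.closedBall_zero, measure_singleton, tsub_zero, one_pow, lintegral_const,
    measure_univ, mul_one] at h
  exact (prob_compl_eq_zero_iff (measurableSet_lt measurable_const measurable_minDist)).2 h

end MinDist

/-! ### Ball averages of the density and Lebesgue differentiation. -/

section BallAverages

variable {d : ℕ} {f : EuclideanSpace ℝ (Fin d) → ℝ}

lemma ballVol_pos (d : ℕ) : 0 < ballVol d :=
  div_pos (Real.rpow_pos_of_pos Real.pi_pos _) (Real.Gamma_pos_of_pos (by positivity))

lemma volume_closedBall_eq (hd : 1 ≤ d) (x : EuclideanSpace ℝ (Fin d)) {r : ℝ} (hr : 0 ≤ r) :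
    volume (Metric.closedBall x r) = ENNReal.ofReal (r ^ d * ballVol d) := by
  have : Nonempty (Fin d) := ⟨⟨0, hd⟩⟩
  rw [EuclideanSpace.volume_closedBall, Fintype.card_fin, ENNReal.ofReal_mul (by positivity),
    ENNReal.ofReal_pow hr, ballVol, Real.sqrt_eq_rpow, ← Real.rpow_mul_natCast Real.pi_pos.le]
  congr 4
  ring

lemma IsProbDensity.isProbabilityMeasure (hf : IsProbDensity f) :
    IsProbabilityMeasure (densityLaw f) := by
  refine ⟨?_⟩
  rw [densityLaw, withDensity_apply _ MeasurableSet.univ, Measure.restrict_univ,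
    ← ofReal_integral_eq_lintegral_ofReal hf.integrable (ae_of_all _ hf.nonneg),
    hf.integral_eq_one, ENNReal.ofReal_one]

lemma densityLaw_absolutelyContinuous : densityLaw f ≪ volume :=
  withDensity_absolutelyContinuous _ _

lemma nullSingletonClass_densityLaw (hd : 1 ≤ d) : NullSingletonClass (densityLaw f) := by
  have : Nonempty (Fin d) := ⟨⟨0, hd⟩⟩
  exact ⟨fun x => densityLaw_absolutelyContinuous (measure_singleton x)⟩

lemma IsProbDensity.aemeasurable (hf : IsProbDensity f) :
    AEMeasurable (fun x => ENNReal.ofReal (f x)) volume :=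
  hf.integrable.aemeasurable.ennreal_ofReal

/-- The function g is arbitrary, so measurability of `maxAvg` and `minAvg`, extrema over uncountable
families, never has to be established. -/
lemma IsProbDensity.lintegral_densityLaw (hf : IsProbDensity f)
    (g : EuclideanSpace ℝ (Fin d) → ℝ≥0∞) :
    ∫⁻ x, g x ∂densityLaw f = ∫⁻ x, g x * ENNReal.ofReal (f x) := by
  rw [densityLaw, lintegral_withDensity_eq_lintegral_mul_non_measurable₀ _ hf.aemeasurable
    (ae_of_all _ fun x => ENNReal.ofReal_lt_top)]
  simp [mul_comm]

lemma IsProbDensity.setLIntegral_densityLaw (hf : IsProbDensity f)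
    (g : EuclideanSpace ℝ (Fin d) → ℝ≥0∞) {s : Set (EuclideanSpace ℝ (Fin d))}
    (hs : MeasurableSet s) :
    ∫⁻ x in s, g x ∂densityLaw f = ∫⁻ x in s, g x * ENNReal.ofReal (f x) := by
  rw [densityLaw, restrict_withDensity hs,
    lintegral_withDensity_eq_lintegral_mul_non_measurable₀ _ hf.aemeasurable.restrict
    (ae_of_all _ fun x => ENNReal.ofReal_lt_top)]
  simp [mul_comm]

lemma ballAvg_eq (x : EuclideanSpace ℝ (Fin d)) (r : ℝ) :
    ballAvg f x r =
      densityLaw f (Metric.closedBall x r) / ENNReal.ofReal (r ^ d * ballVol d) := by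
  rw [ballAvg, densityLaw, withDensity_apply _ Metric.isClosed_closedBall.measurableSet]

lemma natCast_mul_measure_closedBall (n : ℕ) (x : EuclideanSpace ℝ (Fin d)) {r : ℝ}
    (hr : 0 < r) :
    n * densityLaw f (Metric.closedBall x r) =
      ENNReal.ofReal (n * ballVol d * r ^ d) * ballAvg f x r := by
  have h : 0 < r ^ d * ballVol d := mul_pos (pow_pos hr d) (ballVol_pos d)
  rw [ballAvg_eq, mul_assoc, mul_comm (ballVol d), ENNReal.ofReal_mul (Nat.cast_nonneg n),
    ENNReal.ofReal_natCast, mul_assoc,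
    ENNReal.mul_div_cancel (by simpa using h) ENNReal.ofReal_ne_top]

lemma ballAvg_le_maxAvg (x : EuclideanSpace ℝ (Fin d)) {r R : ℝ} (hr : 0 < r) (hrR : r ≤ R) :
    ballAvg f x r ≤ maxAvg f x R :=
  le_iSup₂_of_le r ⟨hr, hrR⟩ le_rfl

lemma minAvg_le_ballAvg (x : EuclideanSpace ℝ (Fin d)) {r R : ℝ} (hr : 0 < r) (hrR : r ≤ R) :
    minAvg f x R ≤ ballAvg f x r :=
  iInf₂_le_of_le r ⟨hr, hrR⟩ le_rfl

lemma measure_minDist_le_maxAvg [IsProbabilityMeasure (densityLaw f)] {n : ℕ} (hn : n ≠ 0)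
    {r R : ℝ} (hr : 0 < r) (hrR : r ≤ R) {a : ℝ} (ha : 0 < a) (ha1 : a ≤ 1) :
    ((densityLaw f).prod (Measure.pi fun _ : Fin n => densityLaw f))
        {z | minDist z.1 z.2 ≤ r} ≤
      ENNReal.ofReal ((n * ballVol d * r ^ d) ^ a) *
        ∫⁻ x, maxAvg f x R ^ a ∂densityLaw f := by
  have hu : 0 < n * ballVol d * r ^ d :=
    mul_pos (mul_pos (by positivity) (ballVol_pos d)) (pow_pos hr d)
  refine (measure_minDist_le _ hn r ha.le ha1).trans ?_
  rw [← lintegral_const_mul' _ _ ENNReal.ofReal_ne_top]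
  refine lintegral_mono fun x => ?_
  rw [natCast_mul_measure_closedBall n x hr, ENNReal.mul_rpow_of_nonneg _ _ ha.le,
    ENNReal.ofReal_rpow_of_pos hu]
  gcongr
  exact ballAvg_le_maxAvg x hr hrR

lemma measure_lt_minDist_le_minAvg [IsProbabilityMeasure (densityLaw f)] {n : ℕ} (hn : n ≠ 0)
    {r R : ℝ} (hr : 0 < r) (hrR : r ≤ R) {a : ℝ} (ha : 0 < a) :
    ((densityLaw f).prod (Measure.pi fun _ : Fin n => densityLaw f))
        {z | r < minDist z.1 z.2} ≤
      ENNReal.ofReal ((n * ballVol d * r ^ d) ^ (-a)) *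
        (ENNReal.ofReal (a ^ a) * ∫⁻ x, minAvg f x R ^ (-a) ∂densityLaw f) := by
  have hu : 0 < n * ballVol d * r ^ d :=
    mul_pos (mul_pos (by positivity) (ballVol_pos d)) (pow_pos hr d)
  refine (measure_lt_minDist_le _ hn r ha).trans ?_
  rw [mul_left_comm]
  gcongr
  rw [← lintegral_const_mul' _ _ ENNReal.ofReal_ne_top]
  refine lintegral_mono fun x => ?_
  rw [natCast_mul_measure_closedBall n x hr, ENNReal.mul_rpow_of_ne_top ENNReal.ofReal_ne_top,
    ENNReal.ofReal_rpow_of_pos hu]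
  · refine mul_le_mul' le_rfl ?_
    rw [ENNReal.rpow_neg, ENNReal.rpow_neg]
    gcongr
    exact minAvg_le_ballAvg x hr hrR
  · rw [ballAvg_eq]
    exact ENNReal.div_ne_top (measure_ne_top _ _)
      (by simpa using mul_pos (pow_pos hr d) (ballVol_pos d))

/-- Pointwise g^a ≤ 1 + g^b, and the measure is finite. -/
lemma lintegral_rpow_ne_top_of_le {α : Type*} [MeasurableSpace α] {μ : Measure α}
    [IsFiniteMeasure μ] {g : α → ℝ≥0∞} {a b : ℝ} (ha : 0 ≤ a) (hab : a ≤ b)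
    (h : ∫⁻ x, g x ^ b ∂μ ≠ ∞) : ∫⁻ x, g x ^ a ∂μ ≠ ∞ := by
  have h1 : ∫⁻ x, (1 + g x ^ b) ∂μ ≠ ∞ := by
    rw [lintegral_add_left measurable_const]
    simp [h]
  refine ne_top_of_le_ne_top h1 (lintegral_mono fun x => ?_)
  rcases le_total (g x) 1 with h2 | h2
  · exact (ENNReal.rpow_le_one h2 ha).trans le_self_add
  · exact (ENNReal.rpow_le_rpow_of_exponent_le h2 hab).trans le_add_self

/-- The Radon-Nikodym density of `densityLaw f`, a measurable version of `f`. -/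
noncomputable def version (f : EuclideanSpace ℝ (Fin d) → ℝ) (x : EuclideanSpace ℝ (Fin d)) : ℝ :=
  ((densityLaw f).rnDeriv volume x).toReal

lemma measurable_version : Measurable (version f) :=
  (Measure.measurable_rnDeriv _ _).ennreal_toReal

lemma version_ae_eq (hf : IsProbDensity f) : version f =ᵐ[volume] f := by
  filter_upwards [Measure.rnDeriv_withDensity₀ volume hf.aemeasurable] with x hx
  rw [version, densityLaw, hx, ENNReal.toReal_ofReal (hf.nonneg x)]

lemma version_pos_ae (hf : IsProbDensity f) : ∀ᵐ x ∂densityLaw f, 0 < version f x := by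
  have := hf.isProbabilityMeasure
  filter_upwards [Measure.rnDeriv_pos (densityLaw_absolutelyContinuous (f := f)),
    densityLaw_absolutelyContinuous.ae_le
      (Measure.rnDeriv_lt_top (densityLaw f) volume)] with x h1 h2
  exact ENNReal.toReal_pos h1.ne' h2.ne

/-- The radius `r` for which `n * volume (closedBall x r) = u`. -/
noncomputable def radius (d n : ℕ) (u : ℝ) : ℝ := (u / (n * ballVol d)) ^ (1 / (d : ℝ))

lemma radius_pos (d : ℕ) {n : ℕ} (hn : n ≠ 0) {u : ℝ} (hu : 0 < u) : 0 < radius d n u :=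
  Real.rpow_pos_of_pos (div_pos hu (mul_pos (by positivity) (ballVol_pos d))) _

lemma mul_radius_pow (hd : 1 ≤ d) {n : ℕ} (hn : n ≠ 0) {u : ℝ} (hu : 0 ≤ u) :
    n * ballVol d * radius d n u ^ d = u := by
  have hV : 0 < n * ballVol d := mul_pos (by positivity) (ballVol_pos d)
  rw [radius, one_div, Real.rpow_inv_natCast_pow (by positivity) (by omega),
    mul_div_cancel₀ _ hV.ne']

lemma tendsto_radius (hd : 1 ≤ d) {u : ℝ} (hu : 0 < u) :
    Tendsto (fun n => radius d n u) atTop (𝓝[>] 0) := by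
  refine tendsto_nhdsWithin_iff.2 ⟨?_, ?_⟩
  · have h1 : Tendsto (fun n : ℕ => u / (n * ballVol d)) atTop (𝓝 0) :=
      (tendsto_natCast_atTop_atTop.atTop_mul_const (ballVol_pos d)).const_div_atTop u
    have hd' : (0 : ℝ) < 1 / d := by positivity
    have h2 := h1.rpow_const (p := 1 / (d : ℝ)) (Or.inr hd'.le)
    rwa [Real.zero_rpow hd'.ne'] at h2
  · filter_upwards [eventually_ne_atTop 0] with n hn
    exact radius_pos d hn hu

/-- The ball has volume u/n, so by differentiation of measures n times its mass tends to u times the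
density; then (1 - t_n/n)^n tends to exp(-t) when t_n tends to t. -/
lemma tendsto_one_sub_measureReal_pow (hd : 1 ≤ d) (hf : IsProbDensity f) {u : ℝ}
    (hu : 0 < u) :
    ∀ᵐ x ∂densityLaw f, Tendsto
      (fun n : ℕ => (1 - (densityLaw f).real (Metric.closedBall x (radius d n u))) ^ n) atTop
      (𝓝 (Real.exp (-(u * version f x)))) := by
  have := hf.isProbabilityMeasure
  filter_upwards [densityLaw_absolutelyContinuous.ae_le
      (Besicovitch.ae_tendsto_rnDeriv (densityLaw f) volume),
    densityLaw_absolutelyContinuous.ae_le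
      (Measure.rnDeriv_lt_top (densityLaw f) volume)] with x h1 h2
  have h3 := (ENNReal.tendsto_toReal h2.ne).comp (h1.comp (tendsto_radius hd hu))
  have h4 := Real.tendsto_one_add_pow_exp_of_tendsto (t := -(u * version f x))
    (g := fun n => -(densityLaw f).real (Metric.closedBall x (radius d n u))) ?_
  · simpa [sub_eq_add_neg] using h4
  · refine ((h3.const_mul u).neg).congr' ?_
    filter_upwards [eventually_ne_atTop 0] with n hn
    have hr := radius_pos d hn hu
    have h5 := mul_radius_pow hd hn hu.le
    have h6 : 0 < radius d n u ^ d * ballVol d := mul_pos (pow_pos hr d) (ballVol_pos d)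
    simp only [Function.comp, ENNReal.toReal_div, Measure.real,
      volume_closedBall_eq hd x hr.le, ENNReal.toReal_ofReal h6.le]
    rw [mul_neg, neg_inj]
    have hV := (ballVol_pos d).ne'
    field_simp
    linear_combination
      -(densityLaw f (Metric.closedBall x (radius d n u))).toReal * h5

end BallAverages

/-! ### Limit and domination of the tails; the truncated expectation. -/

section Tails

variable {d : ℕ} {f : EuclideanSpace ℝ (Fin d) → ℝ}

/-- The joint law of a sample point and `n` further independent sample points. -/
noncomputable abbrev sampleLaw (f : EuclideanSpace ℝ (Fin d) → ℝ) (n : ℕ) :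
    Measure (EuclideanSpace ℝ (Fin d) × (Fin n → EuclideanSpace ℝ (Fin d))) :=
  (densityLaw f).prod (Measure.pi fun _ : Fin n => densityLaw f)

/-- `n` times the volume of the ball around `z.1` that reaches the nearest point of `z.2`. -/
noncomputable def scaledDist {n : ℕ}
    (z : EuclideanSpace ℝ (Fin d) × (Fin n → EuclideanSpace ℝ (Fin d))) : ℝ :=
  n * ballVol d * minDist z.1 z.2 ^ d

lemma measurable_scaledDist {n : ℕ} :
    Measurable fun z : EuclideanSpace ℝ (Fin d) × (Fin n → EuclideanSpace ℝ (Fin d)) =>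
      scaledDist z :=
  (measurable_minDist.pow_const d).const_mul _

lemma scaledDist_pos {n : ℕ} (hn : n ≠ 0)
    {z : EuclideanSpace ℝ (Fin d) × (Fin n → EuclideanSpace ℝ (Fin d))}
    (hz : 0 < minDist z.1 z.2) : 0 < scaledDist z :=
  mul_pos (mul_pos (by positivity) (ballVol_pos d)) (pow_pos hz d)

lemma lt_scaledDist_iff (hd : 1 ≤ d) {n : ℕ} (hn : n ≠ 0) {r : ℝ} (hr : 0 ≤ r)
    (z : EuclideanSpace ℝ (Fin d) × (Fin n → EuclideanSpace ℝ (Fin d))) :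
    n * ballVol d * r ^ d < scaledDist z ↔ r < minDist z.1 z.2 := by
  have hV : 0 < n * ballVol d := mul_pos (by positivity) (ballVol_pos d)
  rw [scaledDist, mul_lt_mul_iff_right₀ hV,
    pow_lt_pow_iff_left₀ hr (minDist_nonneg _ _) (by omega)]

lemma lt_scaledDist_iff_radius (hd : 1 ≤ d) {n : ℕ} (hn : n ≠ 0) {u : ℝ} (hu : 0 < u)
    (z : EuclideanSpace ℝ (Fin d) × (Fin n → EuclideanSpace ℝ (Fin d))) :
    u < scaledDist z ↔ radius d n u < minDist z.1 z.2 := by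
  rw [← lt_scaledDist_iff hd hn (radius_pos d hn hu).le, mul_radius_pow hd hn hu.le]

lemma radius_le (hd : 1 ≤ d) {n : ℕ} (hn : n ≠ 0) {u R : ℝ} (hu : 0 < u) (hR : 0 < R)
    (h : u ≤ n * ballVol d * R ^ d) : radius d n u ≤ R := by
  have hV : 0 < n * ballVol d := mul_pos (by positivity) (ballVol_pos d)
  rwa [← mul_radius_pow hd hn hu.le, mul_le_mul_iff_right₀ hV,
    pow_le_pow_iff_left₀ (radius_pos d hn hu).le hR.le (by omega)] at h

/-- The limit of the tails of `scaledDist`: the tail of a standard exponential variable divided by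
the density at an independent sample point. -/
noncomputable def limitTail (f : EuclideanSpace ℝ (Fin d) → ℝ) (u : ℝ) : ℝ :=
  ∫ x, Real.exp (-(u * version f x)) ∂densityLaw f

lemma tendsto_tail (hd : 1 ≤ d) (hf : IsProbDensity f) {u : ℝ} (hu : 0 < u) :
    Tendsto (fun n => (sampleLaw f n).real {z | u < scaledDist z}) atTop
      (𝓝 (limitTail f u)) := by
  have := hf.isProbabilityMeasure
  have h : Tendsto (fun n : ℕ => ∫ x, (1 - (densityLaw f).real
      (Metric.closedBall x (radius d n u))) ^ n ∂densityLaw f) atTop (𝓝 (limitTail f u)) := by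
    refine tendsto_integral_of_dominated_convergence (fun _ => 1) (fun n => ?_)
      (integrable_const _) (fun n => ae_of_all _ fun x => ?_)
      (tendsto_one_sub_measureReal_pow hd hf hu)
    · exact (((measurable_measure_closedBall _ _).ennreal_toReal.const_sub 1).pow_const
        n).aestronglyMeasurable
    · have h0 : 0 ≤ 1 - (densityLaw f).real (Metric.closedBall x (radius d n u)) :=
        sub_nonneg.2 measureReal_le_one
      rw [Real.norm_of_nonneg (pow_nonneg h0 n)]
      exact pow_le_one₀ h0 (sub_le_self _ measureReal_nonneg)
  refine h.congr' ?_
  filter_upwards [eventually_ne_atTop 0] with n hn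
  simp_rw [lt_scaledDist_iff_radius hd hn hu]
  exact (measureReal_lt_minDist _ hn _).symm

/-- The restriction on u says that the ball of volume u/n has radius at most R, the range in which
`maxAvg` controls the averages. -/
lemma one_sub_tail_le (hd : 1 ≤ d) (hf : IsProbDensity f) {R a : ℝ} (hR : 0 < R) (ha : 0 < a)
    (ha1 : a ≤ 1) (hQ : ∫⁻ x, maxAvg f x R ^ a ∂densityLaw f ≠ ∞) {n : ℕ} (hn : n ≠ 0) {u : ℝ}
    (hu : 0 < u) (huR : u ≤ n * ballVol d * R ^ d) :
    1 - (sampleLaw f n).real {z | u < scaledDist z} ≤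
      u ^ a * (∫⁻ x, maxAvg f x R ^ a ∂densityLaw f).toReal := by
  have := hf.isProbabilityMeasure
  rw [← probReal_compl_eq_one_sub (measurableSet_lt measurable_const measurable_scaledDist)]
  have h := measure_minDist_le_maxAvg (f := f) hn (radius_pos d hn hu)
    (radius_le hd hn hu hR huR) ha ha1
  rw [mul_radius_pow hd hn hu.le] at h
  have h2 : {z : EuclideanSpace ℝ (Fin d) × (Fin n → EuclideanSpace ℝ (Fin d)) |
      u < scaledDist z}ᶜ = {z | minDist z.1 z.2 ≤ radius d n u} := by
    ext z
    simp [← not_lt, lt_scaledDist_iff_radius hd hn hu]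
  rw [h2]
  have h3 := ENNReal.toReal_mono (ENNReal.mul_ne_top ENNReal.ofReal_ne_top hQ) h
  rwa [ENNReal.toReal_mul, ENNReal.toReal_ofReal (by positivity)] at h3

lemma tail_le (hd : 1 ≤ d) (hf : IsProbDensity f) {R b : ℝ} (hR : 0 < R) (hb : 0 < b)
    (hT : ∫⁻ x, minAvg f x R ^ (-b) ∂densityLaw f ≠ ∞) {n : ℕ} (hn : n ≠ 0) {u : ℝ}
    (hu : 0 < u) (huR : u ≤ n * ballVol d * R ^ d) :
    (sampleLaw f n).real {z | u < scaledDist z} ≤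
      u ^ (-b) * (ENNReal.ofReal (b ^ b) * ∫⁻ x, minAvg f x R ^ (-b) ∂densityLaw f).toReal := by
  have := hf.isProbabilityMeasure
  have h := measure_lt_minDist_le_minAvg (f := f) hn (radius_pos d hn hu)
    (radius_le hd hn hu hR huR) hb
  rw [mul_radius_pow hd hn hu.le] at h
  simp_rw [lt_scaledDist_iff_radius hd hn hu]
  have h3 := ENNReal.toReal_mono
    (ENNReal.mul_ne_top ENNReal.ofReal_ne_top (ENNReal.mul_ne_top ENNReal.ofReal_ne_top hT)) h
  rwa [ENNReal.toReal_mul, ENNReal.toReal_ofReal (by positivity)] at h3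

/-- The dominating function for the tail representation of the logarithm. -/
noncomputable def tailBound (a A b B u : ℝ) : ℝ :=
  if u < 1 then u ^ (a - 1) * A else u ^ (-b - 1) * B

lemma integrableOn_tailBound {a A b B : ℝ} (ha : 0 < a) (hb : 0 < b) :
    IntegrableOn (tailBound a A b B) (Set.Ioi 0) := by
  rw [← Set.Ioo_union_Ici_eq_Ioi one_pos]
  refine IntegrableOn.union ?_ ?_
  · have h : IntegrableOn (fun u : ℝ => u ^ (a - 1) * A) (Set.Ioo 0 1) :=
      ((intervalIntegral.integrableOn_Ioo_rpow_iff one_pos).2 (by linarith)).mul_const A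
    exact h.congr_fun (fun u hu => by simp [tailBound, hu.2]) measurableSet_Ioo
  · have h : IntegrableOn (fun u : ℝ => u ^ (-b - 1) * B) (Set.Ici 1) :=
      ((integrableOn_Ici_iff_integrableOn_Ioi).2
        (integrableOn_Ioi_rpow_of_lt (by linarith) one_pos)).mul_const B
    exact h.congr_fun (fun u hu => by simp [tailBound, not_lt.2 (Set.mem_Ici.1 hu)])
      measurableSet_Ici

lemma norm_div_le_tailBound {a A b B u S : ℝ} (hu : 0 < u) (hS0 : 0 ≤ S) (hS1 : S ≤ 1)
    (h1 : u < 1 → 1 - S ≤ u ^ a * A) (h2 : 1 ≤ u → S ≤ u ^ (-b) * B) :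
    ‖(S - if u < 1 then 1 else 0) / u‖ ≤ tailBound a A b B u := by
  rw [norm_div, Real.norm_of_nonneg hu.le, div_le_iff₀ hu, tailBound]
  by_cases h : u < 1
  · simp only [h, if_true]
    rw [Real.norm_eq_abs, abs_sub_comm, abs_of_nonneg (sub_nonneg.2 hS1), mul_right_comm,
      Real.rpow_sub_one hu.ne', div_mul_cancel₀ _ hu.ne']
    exact h1 h
  · simp only [h, if_false, sub_zero]
    rw [Real.norm_of_nonneg hS0, mul_right_comm, Real.rpow_sub_one hu.ne',
      div_mul_cancel₀ _ hu.ne']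
    exact h2 (not_lt.1 h)

lemma tendsto_threshold (d : ℕ) {R : ℝ} (hR : 0 < R) :
    Tendsto (fun n : ℕ => n * ballVol d * R ^ d) atTop atTop :=
  (tendsto_natCast_atTop_atTop.atTop_mul_const (ballVol_pos d)).atTop_mul_const (pow_pos hR d)

lemma measureReal_lt_min {α : Type*} [MeasurableSpace α] (μ : Measure α) (U : α → ℝ) (c u : ℝ) :
    μ.real {z | u < min (U z) c} = if u < c then μ.real {z | u < U z} else 0 := by
  split_ifs with h <;> simp [h]

theorem tendsto_integral_log_min (hd : 1 ≤ d) (hf : IsProbDensity f) {R a b : ℝ} (hR : 0 < R)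
    (ha : 0 < a) (ha1 : a ≤ 1) (hb : 0 < b)
    (hQ : ∫⁻ x, maxAvg f x R ^ a ∂densityLaw f ≠ ∞)
    (hT : ∫⁻ x, minAvg f x R ^ (-b) ∂densityLaw f ≠ ∞) :
    (∀ᶠ n : ℕ in atTop, Integrable
      (fun z => Real.log (min (scaledDist z) (n * ballVol d * R ^ d))) (sampleLaw f n)) ∧
    Tendsto (fun n : ℕ => ∫ z, Real.log (min (scaledDist z) (n * ballVol d * R ^ d))
      ∂sampleLaw f n) atTop
      (𝓝 (∫ u in Set.Ioi (0 : ℝ), (limitTail f u - if u < 1 then 1 else 0) / u)) ∧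
    IntegrableOn (fun u => (limitTail f u - if u < 1 then 1 else 0) / u) (Set.Ioi 0) := by
  have := hf.isProbabilityMeasure
  have := nullSingletonClass_densityLaw (f := f) hd
  set A := (∫⁻ x, maxAvg f x R ^ a ∂densityLaw f).toReal with hA
  set B := (ENNReal.ofReal (b ^ b) * ∫⁻ x, minAvg f x R ^ (-b) ∂densityLaw f).toReal with hB
  set c : ℕ → ℝ := fun n => n * ballVol d * R ^ d with hc
  set S : ℕ → ℝ → ℝ := fun n u => (sampleLaw f n).real {z | u < min (scaledDist z) (c n)} with hS
  have hclim : Tendsto c atTop atTop := tendsto_threshold d hR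
  have hbound : ∀ᶠ n in atTop, ∀ u ∈ Set.Ioi (0 : ℝ),
      ‖(S n u - if u < 1 then 1 else 0) / u‖ ≤ tailBound a A b B u := by
    filter_upwards [eventually_ne_atTop 0, hclim.eventually_ge_atTop 1] with n hn hcn u hu
    refine norm_div_le_tailBound hu measureReal_nonneg measureReal_le_one (fun h => ?_)
      (fun h => ?_)
    · simp only [hS]
      rw [measureReal_lt_min, if_pos (h.trans_le hcn)]
      exact one_sub_tail_le hd hf hR ha ha1 hQ hn hu (h.le.trans hcn)
    · simp only [hS]
      rw [measureReal_lt_min]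
      split_ifs with h2
      · exact tail_le hd hf hR hb hT hn hu h2.le
      -- Beyond the truncation level the tail is zero, so the bound extends to every u ≥ 1; this is
      -- what truncating achieves.
      · have : 0 ≤ u ^ (-b) := Real.rpow_nonneg (le_of_lt hu) _
        positivity
  have hmeas : ∀ n, AEStronglyMeasurable (fun u => (S n u - if u < 1 then 1 else 0) / u)
      (volume.restrict (Set.Ioi (0 : ℝ))) := by
    intro n
    -- Measurability in u comes from monotonicity of the tail.
    have h1 : Antitone (S n) := fun u v huv =>
      measureReal_mono (fun z (hz : v < _) => lt_of_le_of_lt huv hz)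
    exact ((h1.measurable.sub (Measurable.ite measurableSet_Iio measurable_const
      measurable_const)).div measurable_id).aestronglyMeasurable
  have hpt : ∀ u ∈ Set.Ioi (0 : ℝ), Tendsto (fun n => (S n u - if u < 1 then 1 else 0) / u) atTop
      (𝓝 ((limitTail f u - if u < 1 then 1 else 0) / u)) := by
    intro u hu
    refine Tendsto.div_const (Tendsto.sub_const ?_ _) _
    refine (tendsto_tail hd hf hu).congr' ?_
    filter_upwards [hclim.eventually_gt_atTop u] with n hn
    simp only [hS]
    rw [measureReal_lt_min, if_pos hn]
  have hlog : ∀ᶠ n in atTop, Integrable (fun z => Real.log (min (scaledDist z) (c n)))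
      (sampleLaw f n) ∧ ∫ z, Real.log (min (scaledDist z) (c n)) ∂sampleLaw f n =
        ∫ u in Set.Ioi (0 : ℝ), (S n u - if u < 1 then 1 else 0) / u := by
    filter_upwards [eventually_ne_atTop 0, hclim.eventually_gt_atTop 0, hbound] with n hn hcn hb'
    refine integrable_log_of_tail (measurable_scaledDist.min measurable_const).aemeasurable ?_
      (fun u _ => rfl) ?_
    · filter_upwards [minDist_pos_ae (densityLaw f) hn] with z hz
      exact lt_min (scaledDist_pos hn hz) hcn
    · exact (integrableOn_tailBound ha hb).mono' (hmeas n)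
        ((ae_restrict_iff' measurableSet_Ioi).2 (ae_of_all _ hb'))
  refine ⟨hlog.mono fun n h => h.1, ?_, ?_⟩
  · refine Tendsto.congr' (hlog.mono fun n h => h.2.symm) ?_
    exact tendsto_integral_filter_of_dominated_convergence _ (Eventually.of_forall hmeas)
      (hbound.mono fun n h => (ae_restrict_iff' measurableSet_Ioi).2 (ae_of_all _ h))
      (integrableOn_tailBound ha hb) ((ae_restrict_iff' measurableSet_Ioi).2 (ae_of_all _ hpt))
  -- The pointwise limit inherits the dominating function; integrability of f log f will follow from
  -- this.
  · refine (integrableOn_tailBound (A := A) (B := B) ha hb).mono'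
      (aestronglyMeasurable_of_tendsto_ae atTop hmeas
        ((ae_restrict_iff' measurableSet_Ioi).2 (ae_of_all _ hpt)))
      ((ae_restrict_iff' measurableSet_Ioi).2 (ae_of_all _ fun u hu => ?_))
    exact le_of_tendsto (hpt u hu).norm (hbound.mono fun n h => h u hu)

end Tails

/-! ### Identification of the limit with the entropy. -/

section Limit

/-- The standard exponential law. -/
noncomputable def expLaw : Measure ℝ :=
  (volume.restrict (Set.Ioi (0 : ℝ))).withDensity fun t => ENNReal.ofReal (Real.exp (-t))

lemma expLaw_Ioi {v : ℝ} (hv : 0 ≤ v) : expLaw (Set.Ioi v) = ENNReal.ofReal (Real.exp (-v)) := by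
  rw [expLaw, withDensity_apply _ measurableSet_Ioi, Measure.restrict_restrict measurableSet_Ioi,
    Set.inter_eq_left.2 (Set.Ioi_subset_Ioi hv),
    ← ofReal_integral_eq_lintegral_ofReal (integrableOn_exp_neg_Ioi v)
      (ae_of_all _ fun _ => (Real.exp_pos _).le), integral_exp_neg_Ioi]

lemma expLaw_pos_ae : ∀ᵐ t ∂expLaw, 0 < t :=
  (withDensity_absolutelyContinuous _ _).ae_le (ae_restrict_mem measurableSet_Ioi)

instance : IsProbabilityMeasure expLaw := by
  refine ⟨?_⟩
  rw [← measure_eq_measure_of_null_sdiff (Set.subset_univ (Set.Ioi (0 : ℝ))), expLaw_Ioi le_rfl]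
  · simp
  · rw [← Set.compl_eq_univ_sdiff]
    exact expLaw_pos_ae

lemma integral_log_expLaw : ∫ t, Real.log t ∂expLaw = -eulerGamma := by
  rw [expLaw, integral_withDensity_eq_integral_toReal_smul (by fun_prop)
    (ae_of_all _ fun _ => ENNReal.ofReal_lt_top), eulerGamma, neg_neg]
  simp [ENNReal.toReal_ofReal (Real.exp_pos _).le]

variable {d : ℕ} {f : EuclideanSpace ℝ (Fin d) → ℝ}

/-- Given the sample point x, the event says that the exponential variable exceeds u times the
density at x, which has probability exp(-u f(x)). -/
lemma measureReal_expLaw_div_version (hf : IsProbDensity f) {u : ℝ} (hu : 0 < u) :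
    ((densityLaw f).prod expLaw).real {z | u < z.2 / version f z.1} = limitTail f u := by
  have := hf.isProbabilityMeasure
  have hm : Measurable fun z : EuclideanSpace ℝ (Fin d) × ℝ => z.2 / version f z.1 :=
    measurable_snd.div (measurable_version.comp measurable_fst)
  have hm2 : Measurable fun x => Real.exp (-(u * version f x)) :=
    (measurable_version.const_mul u).neg.exp
  rw [measureReal_def, Measure.prod_apply (measurableSet_lt measurable_const hm), limitTail,
    integral_eq_lintegral_of_nonneg_ae (ae_of_all _ fun _ => (Real.exp_pos _).le)
      hm2.aestronglyMeasurable]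
  congr 1
  refine lintegral_congr_ae ?_
  filter_upwards [version_pos_ae hf] with x hx
  rw [← expLaw_Ioi (by positivity)]
  congr 1
  ext t
  simp [lt_div_iff₀ hx]

/-- The limit of the truncated expectations, in terms of the density. -/
theorem integrable_log_version (hf : IsProbDensity f)
    (h : IntegrableOn (fun u => (limitTail f u - if u < 1 then 1 else 0) / u) (Set.Ioi 0)) :
    Integrable (fun x => Real.log (version f x)) (densityLaw f) ∧
      ∫ u in Set.Ioi (0 : ℝ), (limitTail f u - if u < 1 then 1 else 0) / u =
        -eulerGamma - ∫ x, Real.log (version f x) ∂densityLaw f := by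
  have := hf.isProbabilityMeasure
  have hfst : ∀ᵐ z ∂(densityLaw f).prod expLaw, 0 < version f z.1 :=
    Measure.quasiMeasurePreserving_fst.ae (version_pos_ae hf)
  have hsnd : ∀ᵐ z ∂(densityLaw f).prod expLaw, 0 < z.2 :=
    Measure.quasiMeasurePreserving_snd.ae expLaw_pos_ae
  obtain ⟨h1, h2⟩ := integrable_log_of_tail (P := (densityLaw f).prod expLaw)
    (U := fun z => z.2 / version f z.1)
    (measurable_snd.div (measurable_version.comp measurable_fst)).aemeasurable
    (by filter_upwards [hfst, hsnd] with z h1 h2 using div_pos h2 h1)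
    (fun u hu => measureReal_expLaw_div_version hf hu) h
  have hlog : Integrable Real.log expLaw := by
    -- Almost every slice of log(t / f(x)) is integrable in t; one slice with positive density,
    -- shifted by the constant log f(x), gives integrability of log t.
    obtain ⟨x, hx, hx0⟩ := (h1.prod_right_ae.and (version_pos_ae hf)).exists
    refine (hx.add (integrable_const (Real.log (version f x)))).congr ?_
    filter_upwards [expLaw_pos_ae] with t ht
    simp [Real.log_div ht.ne' hx0.ne']
  have hsplit : ∀ᵐ z ∂(densityLaw f).prod expLaw,
      Real.log (z.2 / version f z.1) = Real.log z.2 - Real.log (version f z.1) := by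
    filter_upwards [hfst, hsnd] with z h1 h2 using Real.log_div h2.ne' h1.ne'
  have hlog2 : Integrable (fun z : EuclideanSpace ℝ (Fin d) × ℝ => Real.log z.2)
      ((densityLaw f).prod expLaw) := hlog.comp_snd _
  have hv : Integrable (fun z : EuclideanSpace ℝ (Fin d) × ℝ => Real.log (version f z.1))
      ((densityLaw f).prod expLaw) := by
    refine (hlog2.sub h1).congr ?_
    filter_upwards [hsplit] with z hz
    simp [hz]
  refine ⟨(Integrable.comp_fst_iff (f := fun x => Real.log (version f x))
    (IsProbabilityMeasure.ne_zero expLaw)).1 hv, ?_⟩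
  rw [← h2, integral_congr_ae hsplit, integral_sub hlog2 hv,
    integral_fun_snd (f := Real.log), integral_fun_fst (f := fun x => Real.log (version f x)),
    integral_log_expLaw]
  simp

lemma integrable_mul_log_iff (hf : IsProbDensity f) :
    Integrable (fun x => Real.log (version f x)) (densityLaw f) ↔
      Integrable (fun x => f x * Real.log (f x)) volume := by
  rw [densityLaw, integrable_withDensity_iff_integrable_smul₀' hf.aemeasurable
    (ae_of_all _ fun _ => ENNReal.ofReal_lt_top)]
  refine integrable_congr ?_
  filter_upwards [version_ae_eq hf] with x hx
  simp [hx, ENNReal.toReal_ofReal (hf.nonneg x)]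

lemma integral_log_version (hf : IsProbDensity f) :
    ∫ x, Real.log (version f x) ∂densityLaw f = -entropy f := by
  rw [entropy, neg_neg, densityLaw, integral_withDensity_eq_integral_toReal_smul₀ hf.aemeasurable
    (ae_of_all _ fun _ => ENNReal.ofReal_lt_top)]
  refine integral_congr_ae ?_
  filter_upwards [version_ae_eq hf] with x hx
  simp [hx, ENNReal.toReal_ofReal (hf.nonneg x)]

end Limit

/-! ### Control of large distances by K. -/

section FarNeighbours

variable {d : ℕ} {f : EuclideanSpace ℝ (Fin d) → ℝ}

/-- For s ≥ 3 > e one has log s ≥ 1, hence G(s) ≥ s; the constant 3 covers smaller s. -/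
lemma le_G_add (s : ℝ) : s ≤ G s + 3 := by
  unfold G
  split_ifs with h
  · linarith
  · rw [not_lt] at h
    rcases le_total s 3 with h3 | h3
    · have := mul_nonneg (zero_le_one.trans h) (Real.log_nonneg h)
      linarith
    · have h1 : 1 ≤ Real.log s :=
        (Real.le_log_iff_exp_le (by linarith)).2 (Real.exp_one_lt_three.le.trans h3)
      nlinarith

lemma posLog_div_le {t R : ℝ} (ht : 0 ≤ t) (hR : 0 < R) :
    Real.posLog (t / R) ≤ G |Real.log t| + (3 + |Real.log R|) := by
  have h := le_G_add |Real.log t|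
  have hR' := abs_nonneg (Real.log R)
  have h0 := abs_nonneg (Real.log t)
  refine max_le (by linarith) ?_
  rcases ht.eq_or_lt with rfl | ht
  · simp only [zero_div, Real.log_zero]
    simp only [Real.log_zero] at h h0
    linarith
  · rw [Real.log_div ht.ne' hR.ne']
    linarith [le_abs_self (Real.log t), neg_abs_le (Real.log R)]

lemma lintegral_posLog_dist_ne_top (hd : 1 ≤ d) (hf : IsProbDensity f) {ε R : ℝ} (hε : 0 < ε)
    (hR : 0 < R) (hK : K f ε < ∞) :
    ∫⁻ x, ∫⁻ y, ENNReal.ofReal (Real.posLog (dist x y / R)) ∂densityLaw f ∂densityLaw f ≠ ∞ := by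
  have := hf.isProbabilityMeasure
  have := nullSingletonClass_densityLaw (f := f) hd
  -- The law has no atoms, so omitting the point y = x from the inner integral of K changes nothing.
  have hx : ∀ x : EuclideanSpace ℝ (Fin d), (densityLaw f).restrict {x}ᶜ = densityLaw f :=
    fun x => Measure.restrict_eq_self_of_ae_mem (compl_mem_ae_iff.2 (measure_singleton x))
  have hK' : ∫⁻ x, (∫⁻ y, ENNReal.ofReal (G |Real.log (dist x y)|) ∂densityLaw f) ^ (1 + ε)
      ∂densityLaw f ≠ ∞ := by
    rw [hf.lintegral_densityLaw]
    refine (lt_of_eq_of_lt ?_ hK).ne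
    refine lintegral_congr fun x => ?_
    rw [← hf.setLIntegral_densityLaw _ (measurableSet_singleton x).compl, hx]
  have h1 := lintegral_rpow_ne_top_of_le zero_le_one (le_add_of_nonneg_right hε.le) hK'
  simp_rw [ENNReal.rpow_one] at h1
  have h2 : ∫⁻ x, ((∫⁻ y, ENNReal.ofReal (G |Real.log (dist x y)|) ∂densityLaw f) +
      ENNReal.ofReal (3 + |Real.log R|)) ∂densityLaw f ≠ ∞ := by
    rw [lintegral_add_right _ measurable_const]
    simpa using h1
  refine ne_top_of_le_ne_top h2 (lintegral_mono fun x => ?_)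
  calc ∫⁻ y, ENNReal.ofReal (Real.posLog (dist x y / R)) ∂densityLaw f
      ≤ ∫⁻ y, (ENNReal.ofReal (G |Real.log (dist x y)|) + ENNReal.ofReal (3 + |Real.log R|))
          ∂densityLaw f :=
        lintegral_mono fun y => (ENNReal.ofReal_le_ofReal
          (posLog_div_le dist_nonneg hR)).trans ENNReal.ofReal_add_le
    _ = _ := by
        rw [lintegral_add_right _ measurable_const]
        simp

lemma measurable_posLog_minDist (n : ℕ) (R : ℝ) :
    Measurable fun z : EuclideanSpace ℝ (Fin d) × (Fin n → EuclideanSpace ℝ (Fin d)) =>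
      Real.posLog (minDist z.1 z.2 / R) :=
  measurable_const.max (Real.measurable_log.comp (measurable_minDist.div_const R))

lemma integrable_posLog_minDist_one (hd : 1 ≤ d) (hf : IsProbDensity f) {ε R : ℝ} (hε : 0 < ε)
    (hR : 0 < R) (hK : K f ε < ∞) :
    Integrable (fun z => Real.posLog (minDist z.1 z.2 / R)) (sampleLaw f 1) := by
  have := hf.isProbabilityMeasure
  refine ⟨(measurable_posLog_minDist 1 R).aestronglyMeasurable, ?_⟩
  rw [hasFiniteIntegral_iff_ofReal (ae_of_all _ fun _ => Real.posLog_nonneg),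
    lintegral_prod _ (measurable_posLog_minDist 1 R).ennreal_ofReal.aemeasurable]
  refine lt_of_eq_of_lt ?_ (lintegral_posLog_dist_ne_top hd hf hε hR hK).lt_top
  refine lintegral_congr fun x => ?_
  have hm : Measurable fun y => ENNReal.ofReal (Real.posLog (dist x y / R)) :=
    (measurable_const.max (Real.measurable_log.comp
      ((measurable_const.dist measurable_id).div_const R))).ennreal_ofReal
  rw [← (measurePreserving_eval (fun _ : Fin 1 => densityLaw f) 0).lintegral_comp hm]
  simp [minDist]

/-- Either ρ ≤ R, and both the truncation and log⁺ are inactive, or ρ > R, and d log(ρ/R) is exactly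
what the truncation removes. -/
lemma log_scaledDist (hd : 1 ≤ d) {n : ℕ} (hn : n ≠ 0) {R : ℝ} (hR : 0 < R)
    {z : EuclideanSpace ℝ (Fin d) × (Fin n → EuclideanSpace ℝ (Fin d))}
    (hz : 0 < minDist z.1 z.2) :
    Real.log (scaledDist z) = Real.log (min (scaledDist z) (n * ballVol d * R ^ d)) +
      d * Real.posLog (minDist z.1 z.2 / R) := by
  have hV : 0 < n * ballVol d := mul_pos (by positivity) (ballVol_pos d)
  rcases lt_or_ge R (minDist z.1 z.2) with h | h
  · rw [min_eq_right ((lt_scaledDist_iff hd hn hR.le z).2 h).le, scaledDist,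
      Real.posLog_eq_log (by
        rw [abs_of_pos (div_pos hz hR)]
        exact (one_le_div hR).2 h.le),
      Real.log_mul hV.ne' (pow_pos hz d).ne', Real.log_mul hV.ne' (pow_pos hR d).ne',
      Real.log_div hz.ne' hR.ne', Real.log_pow, Real.log_pow]
    ring
  · have h2 : ¬ n * ballVol d * R ^ d < scaledDist z := by
      rw [lt_scaledDist_iff hd hn hR.le z]
      exact not_lt.2 h
    rw [min_eq_left (not_lt.1 h2), (Real.posLog_eq_zero_iff _).2]
    · simp
    · rw [abs_of_pos (div_pos hz hR)]
      exact (div_le_one hR).2 h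

end FarNeighbours

/-! ### From the i.i.d. sample to the product law; vanishing of the far part. -/

section Sample

variable {d : ℕ} {f : EuclideanSpace ℝ (Fin d) → ℝ} {Ω : Type*} [MeasurableSpace Ω]
  {P : Measure Ω} {X : ℕ → Ω → EuclideanSpace ℝ (Fin d)}

/-- The `i`-th sample point together with the other points. -/
def splitAt {n : ℕ} (i : Fin (n + 1)) (x : Fin (n + 1) → EuclideanSpace ℝ (Fin d)) :
    EuclideanSpace ℝ (Fin d) × (Fin n → EuclideanSpace ℝ (Fin d)) :=
  (x i, fun k => x (i.succAbove k))

lemma nearestDist_eq {n : ℕ} (i : Fin (n + 1)) (x : Fin (n + 1) → EuclideanSpace ℝ (Fin d)) :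
    nearestDist x i = minDist (splitAt i x).1 (splitAt i x).2 :=
  ((finSuccAboveEquiv i).iInf_congr fun _ => rfl).symm

lemma measurePreserving_splitAt (hf : IsProbDensity f)
    (hlaw : ∀ i, HasLaw (X i) (densityLaw f) P) (hindep : iIndepFun X P) {n : ℕ}
    (i : Fin (n + 1)) :
    AEMeasurable (fun ω => splitAt i fun j : Fin (n + 1) => X j ω) P ∧
      P.map (fun ω => splitAt i fun j : Fin (n + 1) => X j ω) = sampleLaw f n := by
  have := hf.isProbabilityMeasure
  have h1 : P.map (fun ω (j : Fin (n + 1)) => X j ω) = Measure.pi fun _ => densityLaw f := by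
    have hi : iIndepFun (fun j : Fin (n + 1) => X j) P := hindep.precomp Fin.val_injective
    have := iIndepFun.map_fun_eq_pi_map (f := fun j : Fin (n + 1) => X j)
      (fun j => (hlaw j).aemeasurable) hi
    simp only [(hlaw _).map_eq] at this
    exact this
  have h2 : AEMeasurable (fun ω (j : Fin (n + 1)) => X j ω) P :=
    aemeasurable_pi_lambda _ fun j => (hlaw j).aemeasurable
  have h3 : MeasurePreserving (splitAt i) (Measure.pi fun _ : Fin (n + 1) => densityLaw f)
      (sampleLaw f n) := measurePreserving_piFinSuccAbove (fun _ => densityLaw f) i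
  refine ⟨h3.measurable.comp_aemeasurable h2, ?_⟩
  rw [← h3.map_eq, ← h1, AEMeasurable.map_map_of_aemeasurable h3.measurable.aemeasurable h2]
  rfl

lemma klEstimate_eq {n : ℕ} (hn : n ≠ 0) {x : Fin (n + 1) → EuclideanSpace ℝ (Fin d)}
    (hx : ∀ i, 0 < minDist (splitAt i x).1 (splitAt i x).2) :
    klEstimate x = (∑ i, Real.log (scaledDist (splitAt i x))) / (n + 1) + eulerGamma := by
  have hlog : ∀ i, Real.log (scaledDist (splitAt i x)) =
      Real.log n + Real.log (ballVol d) + d * Real.log (nearestDist x i) := by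
    intro i
    rw [scaledDist, Real.log_mul (mul_pos (by positivity) (ballVol_pos d)).ne'
      (pow_pos (hx i) d).ne', Real.log_mul (by positivity) (ballVol_pos d).ne', Real.log_pow,
      nearestDist_eq]
  have hpos : ∀ i, 0 < nearestDist x i := fun i => (nearestDist_eq i x).symm ▸ hx i
  rw [klEstimate, meanDist, Real.log_rpow (Finset.prod_pos fun i _ => hpos i),
    Real.log_prod fun i _ => (hpos i).ne']
  simp_rw [hlog]
  rw [Finset.sum_add_distrib, Finset.sum_const, ← Finset.mul_sum]
  have : (n : ℝ) + 1 ≠ 0 := by positivity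
  simp
  field_simp
  ring

lemma minDist_splitAt_zero_le_iff {n : ℕ} (hn : n ≠ 0) {R : ℝ} (x : ℕ → EuclideanSpace ℝ (Fin d)) :
    minDist (splitAt 0 fun j : Fin (n + 1) => x j).1 (splitAt 0 fun j : Fin (n + 1) => x j).2 ≤ R ↔
      ∃ k < n, dist (x 0) (x (k + 1)) ≤ R := by
  rw [minDist_le_iff hn]
  simp only [splitAt, Fin.zero_succAbove, Fin.val_zero, Fin.val_succ]
  exact ⟨fun ⟨k, hk⟩ => ⟨k, k.2, hk⟩, fun ⟨k, hk, h⟩ => ⟨⟨k, hk⟩, h⟩⟩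

theorem tendsto_integral_posLog [IsProbabilityMeasure P] (hd : 1 ≤ d) (hf : IsProbDensity f)
    {ε R b : ℝ} (hε : 0 < ε)
    (hR : 0 < R) (hb : 0 < b) (hK : K f ε < ∞)
    (hT : ∫⁻ x, minAvg f x R ^ (-b) ∂densityLaw f ≠ ∞)
    (hlaw : ∀ i, HasLaw (X i) (densityLaw f) P) (hindep : iIndepFun X P) :
    (∀ n ≠ 0, Integrable (fun z => Real.posLog (minDist z.1 z.2 / R)) (sampleLaw f n)) ∧
      Tendsto (fun n => ∫ z, Real.posLog (minDist z.1 z.2 / R) ∂sampleLaw f n) atTop (𝓝 0) := by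
  have := hf.isProbabilityMeasure
  -- All sample sizes are coupled on Ω: the point `X 0` stays fixed and its sets of other points are
  -- nested, so its nearest neighbour distance is monotone in n.
  set Y : ∀ n : ℕ, Ω → EuclideanSpace ℝ (Fin d) × (Fin n → EuclideanSpace ℝ (Fin d)) :=
    fun n ω => splitAt 0 fun j : Fin (n + 1) => X j ω with hY
  have hYm : ∀ n, AEMeasurable (Y n) P := fun n =>
    (measurePreserving_splitAt hf hlaw hindep 0).1
  have hYlaw : ∀ n, P.map (Y n) = sampleLaw f n := fun n =>
    (measurePreserving_splitAt hf hlaw hindep 0).2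
  set F : ℕ → Ω → ℝ := fun n ω => Real.posLog (minDist (Y n ω).1 (Y n ω).2 / R) with hF
  have hFm : ∀ n, AEStronglyMeasurable (F n) P := fun n =>
    ((measurable_posLog_minDist n R).comp_aemeasurable (hYm n)).aestronglyMeasurable
  have hmono : ∀ m n : ℕ, m ≠ 0 → m ≤ n → ∀ ω,
      minDist (Y n ω).1 (Y n ω).2 ≤ minDist (Y m ω).1 (Y m ω).2 := by
    intro m n hm hmn ω
    obtain ⟨k, hk, h⟩ := (minDist_splitAt_zero_le_iff hm fun j => X j ω).1 le_rfl
    exact (minDist_splitAt_zero_le_iff (by omega) fun j => X j ω).2 ⟨k, by omega, h⟩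
  have hF1 : Integrable (F 1) P := by
    have h := integrable_posLog_minDist_one hd hf hε hR hK
    rwa [← hYlaw, integrable_map_measure (measurable_posLog_minDist 1 R).aestronglyMeasurable
      (hYm 1)] at h
  have hbound : ∀ n ≠ 0, ∀ ω, ‖F n ω‖ ≤ F 1 ω := by
    intro n hn ω
    rw [Real.norm_of_nonneg Real.posLog_nonneg]
    refine Real.posLog_le_posLog (div_nonneg (minDist_nonneg _ _) hR.le) ?_
    have := hmono 1 n one_ne_zero (by omega) ω
    gcongr
  -- Having no neighbour within R at any size has probability at most P(ζ > n V_d R^d) for each n ≠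
  -- 0, and this tends to 0 by the bound from T.
  have hnear : ∀ᵐ ω ∂P, ∃ m ≠ 0, minDist (Y m ω).1 (Y m ω).2 ≤ R := by
    set B := (ENNReal.ofReal (b ^ b) * ∫⁻ x, minAvg f x R ^ (-b) ∂densityLaw f).toReal
    have hlim : Tendsto (fun n : ℕ => (n * ballVol d * R ^ d) ^ (-b) * B) atTop (𝓝 0) := by
      simpa using ((tendsto_rpow_neg_atTop hb).comp (tendsto_threshold d hR)).mul_const B
    have hle : ∀ᶠ n : ℕ in atTop,
        P.real {ω | ¬ ∃ m ≠ 0, minDist (Y m ω).1 (Y m ω).2 ≤ R} ≤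
          (n * ballVol d * R ^ d) ^ (-b) * B := by
      filter_upwards [eventually_ne_atTop 0] with n hn
      have hV : 0 < n * ballVol d := mul_pos (by positivity) (ballVol_pos d)
      refine le_trans ?_ (tail_le hd hf hR hb hT hn (mul_pos hV (pow_pos hR d)) le_rfl)
      rw [← hYlaw, map_measureReal_apply_of_aemeasurable (hYm n)
        (measurableSet_lt measurable_const measurable_scaledDist)]
      refine measureReal_mono fun ω hω => ?_
      simp only [Set.mem_preimage, Set.mem_ofPred_eq]
      rw [lt_scaledDist_iff hd hn hR.le]
      by_contra h
      exact hω ⟨n, hn, not_lt.1 h⟩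
    have h0 := ge_of_tendsto hlim hle
    rw [ae_iff]
    exact (measureReal_eq_zero_iff).1 (le_antisymm h0 measureReal_nonneg)
  have hzero : ∀ᵐ ω ∂P, Tendsto (fun n => F n ω) atTop (𝓝 0) := by
    filter_upwards [hnear] with ω ⟨m, hm, h⟩
    refine tendsto_const_nhds.congr' ?_
    filter_upwards [eventually_ge_atTop m] with n hn
    have h1 := (hmono m n hm hn ω).trans h
    symm
    rw [hF, Real.posLog_eq_zero_iff, abs_of_nonneg (div_nonneg (minDist_nonneg _ _) hR.le)]
    exact (div_le_one hR).2 h1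
  refine ⟨fun n hn => ?_, ?_⟩
  · rw [← hYlaw, integrable_map_measure (measurable_posLog_minDist n R).aestronglyMeasurable
      (hYm n)]
    exact hF1.mono' (hFm n) (ae_of_all _ (hbound n hn))
  · have h := tendsto_integral_filter_of_dominated_convergence (F 1) (Eventually.of_forall hFm)
      ((eventually_ne_atTop 0).mono fun n hn => ae_of_all _ (hbound n hn)) hF1 hzero
    simp only [integral_zero] at h
    refine h.congr fun n => ?_
    rw [← hYlaw, integral_map (hYm n) (measurable_posLog_minDist n R).aestronglyMeasurable]

end Sample

end KozachenkoLeonenko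

/-! ### Assembly of the near and far parts. -/

theorem corollary1 {d : ℕ} (hd : 1 ≤ d)
    (f : EuclideanSpace ℝ (Fin d) → ℝ) (hf : IsProbDensity f)
    (ε : ℝ) (hε : 0 < ε)
    (hK : KozachenkoLeonenko.K f ε < ∞)
    (hQ : KozachenkoLeonenko.Q f ε ε < ∞)
    (hT : KozachenkoLeonenko.T f ε ε < ∞)
    {Ω : Type*} [MeasurableSpace Ω] (P : Measure Ω) [IsProbabilityMeasure P]
    (X : ℕ → Ω → EuclideanSpace ℝ (Fin d))
    (hlaw : ∀ i, HasLaw (X i) (densityLaw f) P)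
    (hindep : iIndepFun X P) :
    Integrable (fun x => f x * Real.log (f x)) volume ∧
    (∀ᶠ N : ℕ in atTop,
      Integrable (fun ω => klEstimate (fun i : Fin N => X i ω)) P) ∧
    Tendsto (fun N : ℕ => ∫ ω, klEstimate (fun i : Fin N => X i ω) ∂P) atTop
      (𝓝 (entropy f)) := by
  have := hf.isProbabilityMeasure
  have := nullSingletonClass_densityLaw (f := f) hd
  -- The union bound needs an exponent at most 1, so ε is lowered to min(ε, 1).
  have hQ' : ∫⁻ x, maxAvg f x ε ^ (min ε 1) ∂densityLaw f ≠ ∞ := by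
    refine lintegral_rpow_ne_top_of_le (b := ε) (le_min hε.le zero_le_one) (min_le_left _ _) ?_
    rw [hf.lintegral_densityLaw]
    exact hQ.ne
  have hT' : ∫⁻ x, minAvg f x ε ^ (-ε) ∂densityLaw f ≠ ∞ := by
    rw [hf.lintegral_densityLaw]
    exact hT.ne
  obtain ⟨hmin, hminlim, hlim⟩ := tendsto_integral_log_min hd hf hε (lt_min hε one_pos)
    (min_le_right _ _) hε hQ' hT'
  obtain ⟨hfar, hfarlim⟩ := tendsto_integral_posLog hd hf hε hε hε hK hT' hlaw hindep
  obtain ⟨hent, henteq⟩ := integrable_log_version hf hlim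
  rw [henteq, integral_log_version hf] at hminlim
  have hlog : ∀ᶠ n : ℕ in atTop, n ≠ 0 ∧
      Integrable (fun z => Real.log (scaledDist z)) (sampleLaw f n) ∧
      ∫ z, Real.log (scaledDist z) ∂sampleLaw f n =
        ∫ z, Real.log (min (scaledDist z) (n * ballVol d * ε ^ d)) ∂sampleLaw f n +
          d * ∫ z, Real.posLog (minDist z.1 z.2 / ε) ∂sampleLaw f n := by
    filter_upwards [hmin, eventually_ne_atTop 0] with n h1 hn
    have h2 : (fun z => Real.log (scaledDist z)) =ᵐ[sampleLaw f n] fun z =>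
        Real.log (min (scaledDist z) (n * ballVol d * ε ^ d)) +
          d * Real.posLog (minDist z.1 z.2 / ε) :=
      (minDist_pos_ae (densityLaw f) hn).mono fun z hz => log_scaledDist hd hn hε hz
    refine ⟨hn, (h1.add ((hfar n hn).const_mul _)).congr h2.symm, ?_⟩
    rw [integral_congr_ae h2, integral_add h1 ((hfar n hn).const_mul _), integral_const_mul]
  have hloglim : Tendsto (fun n : ℕ => ∫ z, Real.log (scaledDist z) ∂sampleLaw f n) atTop
      (𝓝 (-eulerGamma + entropy f)) := by
    have h := hminlim.add (hfarlim.const_mul (d : ℝ))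
    rw [mul_zero, add_zero, sub_neg_eq_add] at h
    exact h.congr' (hlog.mono fun n h => h.2.2.symm)
  -- With N = n + 1 points each one has n others. The N summands share one law, so the expected
  -- average equals a single expectation.
  have hest : ∀ᶠ n : ℕ in atTop,
      Integrable (fun ω => klEstimate (fun i : Fin (n + 1) => X i ω)) P ∧
      ∫ z, Real.log (scaledDist z) ∂sampleLaw f n + eulerGamma =
        ∫ ω, klEstimate (fun i : Fin (n + 1) => X i ω) ∂P := by
    filter_upwards [hlog] with n ⟨hn, hint, _⟩
    have hm : AEStronglyMeasurable (fun z => Real.log (scaledDist z)) (sampleLaw f n) :=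
      hint.aestronglyMeasurable
    have hint' : ∀ i : Fin (n + 1), Integrable
        (fun ω => Real.log (scaledDist (splitAt i fun j : Fin (n + 1) => X j ω))) P ∧
        ∫ ω, Real.log (scaledDist (splitAt i fun j : Fin (n + 1) => X j ω)) ∂P =
          ∫ z, Real.log (scaledDist z) ∂sampleLaw f n := by
      intro i
      obtain ⟨h1, h2⟩ := measurePreserving_splitAt hf hlaw hindep i
      rw [← h2] at hm hint
      refine ⟨(integrable_map_measure hm h1).1 hint, ?_⟩
      rw [← h2, integral_map h1 hm]
    have hae : (fun ω => klEstimate (fun i : Fin (n + 1) => X i ω)) =ᵐ[P] fun ω =>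
        (∑ i, Real.log (scaledDist (splitAt i fun j : Fin (n + 1) => X j ω))) / (n + 1) +
          eulerGamma := by
      have : ∀ᵐ ω ∂P, ∀ i, 0 < minDist (splitAt i fun j : Fin (n + 1) => X j ω).1
          (splitAt i fun j : Fin (n + 1) => X j ω).2 := by
        refine ae_all_iff.2 fun i => ?_
        obtain ⟨h1, h2⟩ := measurePreserving_splitAt hf hlaw hindep i
        have h3 := minDist_pos_ae (densityLaw f) hn
        rw [← sampleLaw, ← h2] at h3
        exact ae_of_ae_map h1 h3
      exact this.mono fun ω h => klEstimate_eq hn h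
    have hsum : Integrable (fun ω => (∑ i, Real.log (scaledDist (splitAt i
        fun j : Fin (n + 1) => X j ω))) / ((n : ℝ) + 1)) P :=
      (integrable_finsetSum _ fun i _ => (hint' i).1).div_const _
    refine ⟨(hsum.add (integrable_const eulerGamma)).congr hae.symm, ?_⟩
    rw [integral_congr_ae hae, integral_add hsum (integrable_const _), integral_div,
      integral_finsetSum _ fun i _ => (hint' i).1]
    simp_rw [fun i => (hint' i).2]
    have : (n : ℝ) + 1 ≠ 0 := by positivity
    simp
    field_simp
  refine ⟨(integrable_mul_log_iff hf).1 hent, ?_, ?_⟩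
  · obtain ⟨m, hm⟩ := eventually_atTop.1 hest
    refine eventually_atTop.2 ⟨m + 1, fun N hN => ?_⟩
    obtain ⟨n, rfl⟩ : ∃ n, N = n + 1 := ⟨N - 1, by omega⟩
    exact (hm n (by omega)).1
  · rw [← tendsto_add_atTop_iff_nat 1]
    have h := hloglim.add_const eulerGamma
    rw [neg_add_cancel_comm] at h
    exact h.congr' (hest.mono fun n h => h.2)
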